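/- Let $T_0>0$, let $H$ and $U$ be complex Hilbert spaces, let $A$ be an unbounded operator on $H$ generating a strongly continuous semigroup $(e^{tA})_{t\ge 0}$ of bounded operators on $H$, and let $B\colon U\to H$ be a bounded linear operator. For every $T>0$, let $U_T$ be a complex Hilbert space that is a subspace of $L^2(0,T;U)$ with continuous and dense injection. Assume the following extension-by-zero property: if $T,a,b>0$ and $u\in U_T$, then the function $\widetilde u$ on $(0,T+a+b)$ defined by $\widetilde u(t)=u(t-a)$ for $a<t<T+a$ and $\widetilde u(t)=0$ for $0<t<a$ and for $T+a<t<T+a+b$ belongs to $U_{T+a+b}$. For $f_0\in H$ and $u\in L^2(0,T;U)$, the solution of $f'=Af+Bu$, $f(0)=f_0$ is the mild solution $f(t)=e^{tA}f_0+\int_0^t e^{(t-s)A}Bu(s)\,ds$, $0\le t\le T$. A generalized eigenvector of $A^*$ is an element of $\ker (A^*-\mu)^k$ for some $\mu\in\mathbb C$ and $k\ge 1$, and $e^{tA^*}=(e^{tA})^*$. Assume that there exist a finite-dimensional subspace $\mathcal F$ of $H$ with $e^{tA}\mathcal F\subset\mathcal F$ for all $t\ge 0$, and a closed subspace $\mathcal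 G$ of $H$ of finite codimension (not required to be invariant under $e^{tA}$), such that: 1. (control up to finite dimension) for every $f_0\in\mathcal G$, there exists $u\in U_{T_0}$ such that the solution of $f'=Af+Bu$, $f(0)=f_0$ satisfies $f(T_0)\in\mathcal F$; 2. (unique continuation) for every $\epsilon>0$ and every finite linear combination $g_0\in H$ of generalized eigenvectors of $A^*$, if $B^*e^{tA^*}g_0=0$ for all $t\in(0,\epsilon)$, then $g_0=0$. Then, for every $T>T_0$ and every $f_0\in H$, there exists $u\in U_T$ such that the solution of $f'=Af+Bu$, $f(0)=f_0$ satisfies $f(T)=0$. -/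

import Mathlib

open MeasureTheory Filter Topology Set

noncomputable section

variable {H : Type*} [NormedAddCommGroup H] [InnerProductSpace ℂ H]

/-- `S` is a strongly continuous semigroup of bounded operators on `H`. Only the values `S t` with
`0 ≤ t` are relevant. -/
structure IsC0Semigroup (S : ℝ → H →L[ℂ] H) : Prop where
  map_zero : S 0 = ContinuousLinearMap.id ℂ H
  map_add : ∀ s t : ℝ, 0 ≤ s → 0 ≤ t → S (s + t) = (S s).comp (S t)
  continuousOn : ∀ x : H, ContinuousOn (fun t : ℝ => S t x) (Ici 0)

/-- The unbounded operator `A` generates the strongly continuous semigroup `S`, i.e. `S t = e^{tA}`: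
the graph of `A` is exactly the set of pairs `(x, y)` with `(S t x - x) / t → y` as `t → 0⁺`. -/
structure Generates (A : H →ₗ.[ℂ] H) (S : ℝ → H →L[ℂ] H) : Prop where
  isC0Semigroup : IsC0Semigroup S
  mem_graph_iff : ∀ x y : H, (x, y) ∈ A.graph ↔
    Tendsto (fun t : ℝ => (t : ℂ)⁻¹ • (S t x - x)) (𝓝[>] 0) (𝓝 y)

/-- `g` lies in the domain of `(A - μ)^k` and `(A - μ)^k g = 0`. -/
def InKerPow (A : H →ₗ.[ℂ] H) (μ : ℂ) : ℕ → H → Prop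
  | 0, g => g = 0
  | k + 1, g => ∃ hg : g ∈ A.domain, InKerPow A μ k (A ⟨g, hg⟩ - μ • g)

/-- The space of finite linear combinations of generalized eigenvectors of `A`
(for arbitrary, possibly different, eigenvalues). -/
def genEigenSpan (A : H →ₗ.[ℂ] H) : Submodule ℂ H :=
  Submodule.span ℂ {g : H | ∃ (μ : ℂ) (k : ℕ), InKerPow A μ k g}

/-- The space `L²(0,T; U)`. -/
abbrev L2Control (U : Type*) [NormedAddCommGroup U] (T : ℝ) : Type _ :=
  Lp U 2 (volume.restrict (Ioo (0 : ℝ) T))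

/-- The value at time `t` of the (mild) solution of `f' = A f + B u`, `f 0 = f₀`, where `S` is the
semigroup generated by `A`: the Duhamel formula
`f t = S t f₀ + ∫ s in 0..t, S (t - s) (B (u s))`. -/
def mildSolution {U : Type*} [NormedAddCommGroup U] [InnerProductSpace ℂ U]
    (S : ℝ → H →L[ℂ] H) (B : U →L[ℂ] H) (f₀ : H) (u : ℝ → U) (t : ℝ) : H :=
  S t f₀ + ∫ s in (0 : ℝ)..t, S (t - s) (B (u s))

end

/-! Let `R t` be the space reachable from 0 at time `t` and `N t` the preimage of `R t` under `S t`: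
the data steerable to 0 at time `t`. Control up to finite dimension gives `N T₀` finite codimension.
Extension by zero lets a control be preceded and followed by free evolution, so the codimension of
`N t` is nonincreasing in `t`.

At a time `T₁` in `(T₀, T)` of minimal codimension, `N = N T₁` is stationary for a short while: for
small `a > 0`, `S a x ∈ N` iff `x ∈ N`. Hence `N` is invariant under the semigroup, and it contains
`R s` for small `s` (`exists_stable_subspace`). It is closed, as a range of finite codimension
(`isClosed_comap_reach`).

So `Nᗮ` is finite-dimensional and invariant under the adjoint semigroup, hence made of sums of
generalized eigenvectors of `A*` (`le_genEigenSpan_adjoint`). Being orthogonal to `R s`, these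
vectors are unobservable on `(0, s)` (`observation_eq_zero`). Unique continuation yields `Nᗮ = 0`,
so `N` is everything. -/

noncomputable section

/-! ### Subspaces of finite codimension -/

variable {H : Type*} [NormedAddCommGroup H] [InnerProductSpace ℂ H]

/-- Adding a finite-dimensional complement `C` to the source makes the map onto, hence open; the
complement of the range is then the image of the open set of pairs with nonzero `C`-component. -/
theorem ContinuousLinearMap.isClosed_range_of_finite_quotient {E F : Type*}
    [NormedAddCommGroup E] [NormedSpace ℂ E] [CompleteSpace E]
    [NormedAddCommGroup F] [NormedSpace ℂ F] [CompleteSpace F] (f : E →L[ℂ] F)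
    (hf : FiniteDimensional ℂ (F ⧸ LinearMap.range (f : E →ₗ[ℂ] F))) :
    IsClosed (Set.range f) := by
  obtain ⟨C, hC⟩ := (LinearMap.range (f : E →ₗ[ℂ] F)).exists_isCompl
  have : FiniteDimensional ℂ C :=
    LinearEquiv.finiteDimensional (Submodule.quotientEquivOfIsCompl _ C hC)
  have : CompleteSpace C := FiniteDimensional.complete ℂ C
  let g : E × C →L[ℂ] F := f.coprod C.subtypeL
  have hg : Function.Surjective g := by
    intro y
    have hy : y ∈ LinearMap.range (f : E →ₗ[ℂ] F) ⊔ C := by rw [hC.sup_eq_top]; trivial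
    obtain ⟨_, ⟨x, rfl⟩, c, hc, rfl⟩ := Submodule.mem_sup.1 hy
    exact ⟨(x, ⟨c, hc⟩), by simp [g]⟩
  have hopen := g.isOpenMap hg
  have key : (Set.range f)ᶜ = g '' {p | p.2 ≠ 0} := by
    ext y
    constructor
    · intro hy
      obtain ⟨⟨x, c⟩, rfl⟩ := hg y
      refine ⟨(x, c), ?_, rfl⟩
      rintro (rfl : c = 0)
      exact hy ⟨x, by simp [g]⟩
    · rintro ⟨⟨x, c⟩, hc, rfl⟩ ⟨z, hz⟩
      apply hc
      have h1 : (c : F) = f (z - x) := by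
        simp only [g, ContinuousLinearMap.coprod_apply, Submodule.subtypeL_apply] at hz
        rw [map_sub, hz]; abel
      have h2 : (c : F) ∈ LinearMap.range (f : E →ₗ[ℂ] F) ⊓ C :=
        ⟨⟨z - x, h1.symm⟩, c.2⟩
      rw [hC.inf_eq_bot] at h2
      exact Subtype.ext h2
  rw [← isOpen_compl_iff, key]
  exact hopen _ (isOpen_ne_fun continuous_snd continuous_const)

theorem Submodule.finite_quotient_comap {V W : Type*} [AddCommGroup V] [Module ℂ V]
    [AddCommGroup W] [Module ℂ W] (f : V →ₗ[ℂ] W) (N : Submodule ℂ W)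
    [FiniteDimensional ℂ (W ⧸ N)] :
    FiniteDimensional ℂ (V ⧸ N.comap f) ∧
      Module.finrank ℂ (V ⧸ N.comap f) ≤ Module.finrank ℂ (W ⧸ N) := by
  have hinj : Function.Injective (Submodule.mapQ (N.comap f) N f le_rfl) := by
    rw [← LinearMap.ker_eq_bot, Submodule.ker_mapQ]
    simp
  exact ⟨Module.Finite.of_injective _ hinj, LinearMap.finrank_le_finrank_of_injective hinj⟩

theorem Submodule.surjective_mod_of_finrank_comap {V W : Type*} [AddCommGroup V] [Module ℂ V]
    [AddCommGroup W] [Module ℂ W] (f : V →ₗ[ℂ] W) (N : Submodule ℂ W)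
    [FiniteDimensional ℂ (W ⧸ N)]
    (h : Module.finrank ℂ (V ⧸ N.comap f) = Module.finrank ℂ (W ⧸ N)) (y : W) :
    ∃ x, f x - y ∈ N := by
  have hinj : Function.Injective (Submodule.mapQ (N.comap f) N f le_rfl) := by
    rw [← LinearMap.ker_eq_bot, Submodule.ker_mapQ]
    simp
  have := (Submodule.finite_quotient_comap f N).1
  have hsurj := (LinearMap.injective_iff_surjective_of_finrank_eq_finrank h).1 hinj
  obtain ⟨q, hq⟩ := hsurj (Submodule.Quotient.mk y)
  obtain ⟨x, rfl⟩ := Submodule.Quotient.mk_surjective _ q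
  exact ⟨x, (Submodule.Quotient.eq N).1 hq⟩

theorem Submodule.finrank_quotient_anti {V : Type*} [AddCommGroup V] [Module ℂ V]
    {N M : Submodule ℂ V} (h : N ≤ M) [FiniteDimensional ℂ (V ⧸ N)] :
    FiniteDimensional ℂ (V ⧸ M) ∧
      Module.finrank ℂ (V ⧸ M) ≤ Module.finrank ℂ (V ⧸ N) := by
  have hs := Submodule.factor_surjective h
  exact ⟨Module.Finite.of_surjective _ hs, LinearMap.finrank_le_finrank_of_surjective hs⟩

theorem Submodule.eq_of_le_of_finrank_quotient_le {V : Type*} [AddCommGroup V] [Module ℂ V]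
    {N M : Submodule ℂ V} (h : N ≤ M) [FiniteDimensional ℂ (V ⧸ N)]
    (hr : Module.finrank ℂ (V ⧸ N) ≤ Module.finrank ℂ (V ⧸ M)) : N = M := by
  have hs := Submodule.factor_surjective h
  have := (Submodule.finrank_quotient_anti h).1
  have hinj := (LinearMap.injective_iff_surjective_of_finrank_eq_finrank
    (le_antisymm hr (Submodule.finrank_quotient_anti h).2)).2 hs
  refine le_antisymm h fun x hx => ?_
  have : Submodule.factor h (Submodule.Quotient.mk x) = Submodule.factor h 0 := by
    rw [map_zero]; exact (Submodule.Quotient.mk_eq_zero M).2 hx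
  exact (Submodule.Quotient.mk_eq_zero N).1 (hinj this)

/-- Modulo `R`, the range of `f` is spanned by the images of `F` and of a complement of `G`, both
finite-dimensional. -/
theorem Submodule.finite_quotient_comap_of_map_le {V W : Type*} [AddCommGroup V] [Module ℂ V]
    [AddCommGroup W] [Module ℂ W] (f : V →ₗ[ℂ] W) (G : Submodule ℂ V) (F R : Submodule ℂ W)
    [FiniteDimensional ℂ (V ⧸ G)] [FiniteDimensional ℂ F] (h : G.map f ≤ F ⊔ R) :
    FiniteDimensional ℂ (V ⧸ R.comap f) := by
  obtain ⟨C, hC⟩ := G.exists_isCompl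
  have : FiniteDimensional ℂ C :=
    LinearEquiv.finiteDimensional (Submodule.quotientEquivOfIsCompl _ C hC)
  let g : V →ₗ[ℂ] W ⧸ R := R.mkQ ∘ₗ f
  have hker : LinearMap.ker g = R.comap f := by
    ext x; simp [g]
  have hrange : LinearMap.range g ≤ F.map R.mkQ ⊔ C.map g := by
    rw [← Submodule.map_top, ← hC.sup_eq_top, Submodule.map_sup]
    refine sup_le_sup_right ?_ _
    rw [Submodule.map_comp]
    refine (Submodule.map_mono h).trans ?_
    rw [Submodule.map_sup]
    refine sup_le le_rfl ?_
    rw [Submodule.mkQ_map_self]; exact bot_le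
  have : FiniteDimensional ℂ (LinearMap.range g) := Submodule.finiteDimensional_of_le hrange
  rw [← hker]
  exact LinearEquiv.finiteDimensional g.quotKerEquivRange.symm

/-! ### Strongly continuous semigroups -/

namespace IsC0Semigroup

variable {S : ℝ → H →L[ℂ] H}

theorem apply_add (hS : IsC0Semigroup S) {s t : ℝ} (hs : 0 ≤ s) (ht : 0 ≤ t) (x : H) :
    S (s + t) x = S s (S t x) := by
  rw [hS.map_add s t hs ht]; rfl

/-- Freezing the orbit at negative times makes it continuous on all of `ℝ`, so that measurability
and two-sided differentiation of integrals apply. -/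
theorem continuous_max (hS : IsC0Semigroup S) (x : H) :
    Continuous fun t : ℝ => S (max t 0) x :=
  (hS.continuousOn x).comp_continuous (by fun_prop) fun _ => mem_Ici.2 (le_max_right _ _)

theorem tendsto_zero (hS : IsC0Semigroup S) (x : H) :
    Tendsto (fun t : ℝ => S t x) (𝓝[>] 0) (𝓝 x) := by
  have h := (hS.continuousOn x 0 (mem_Ici.2 le_rfl)).mono_left (nhdsWithin_mono _ Ioi_subset_Ici_self)
  simpa [hS.map_zero] using h

theorem exists_norm_le [CompleteSpace H] (hS : IsC0Semigroup S) (T : ℝ) :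
    ∃ M : ℝ, 0 ≤ M ∧ ∀ t, t ≤ T → ‖S (max t 0)‖ ≤ M := by
  obtain ⟨M, hM⟩ := banach_steinhaus (g := fun t : Icc (0 : ℝ) (max T 0) => S t) (by
    intro x
    obtain ⟨C, hC⟩ := isCompact_Icc.exists_bound_of_continuousOn (s := Icc (0 : ℝ) (max T 0))
      ((hS.continuousOn x).mono fun t ht => ht.1)
    exact ⟨C, fun t => hC t t.2⟩)
  refine ⟨M, (norm_nonneg _).trans (hM ⟨0, le_rfl, le_max_right _ _⟩), fun t ht => ?_⟩
  exact hM ⟨max t 0, le_max_right _ _, max_le_max_right _ ht⟩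

theorem continuous_uncurry [CompleteSpace H] (hS : IsC0Semigroup S) :
    Continuous fun p : ℝ × H => S (max p.1 0) p.2 := by
  rw [continuous_iff_continuousAt]
  rintro ⟨t, x⟩
  obtain ⟨M, hM0, hM⟩ := hS.exists_norm_le (t + 1)
  have h1 : Tendsto (fun p : ℝ × H => S (max p.1 0) x) (𝓝 (t, x)) (𝓝 (S (max t 0) x)) :=
    ((hS.continuous_max x).comp continuous_fst).tendsto (t, x)
  have h2 : Tendsto (fun p : ℝ × H => S (max p.1 0) (p.2 - x)) (𝓝 (t, x)) (𝓝 0) := by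
    have h3 : Tendsto (fun p : ℝ × H => M * ‖p.2 - x‖) (𝓝 (t, x)) (𝓝 0) := by
      have : Continuous fun p : ℝ × H => M * ‖p.2 - x‖ := by fun_prop
      simpa using this.tendsto (t, x)
    refine squeeze_zero_norm' ?_ h3
    have : ∀ᶠ p : ℝ × H in 𝓝 (t, x), p.1 < t + 1 :=
      (continuous_fst.tendsto (t, x)).eventually (gt_mem_nhds (lt_add_one t))
    filter_upwards [this] with p hp
    exact (S (max p.1 0)).le_of_opNorm_le (hM _ hp.le) _
  simpa [ContinuousAt] using h1.add h2

/-- The vectors at which the orbit of the semigroup is differentiable at time zero. -/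
def diffDomain (S : ℝ → H →L[ℂ] H) : Submodule ℂ H where
  carrier := {x | ∃ y, Tendsto (fun t : ℝ => (t : ℂ)⁻¹ • (S t x - x)) (𝓝[>] 0) (𝓝 y)}
  zero_mem' := ⟨0, by simp⟩
  add_mem' := by
    rintro x x' ⟨y, hy⟩ ⟨y', hy'⟩
    refine ⟨y + y', (hy.add hy').congr fun t => ?_⟩
    rw [← smul_add, _root_.map_add]; congr 1; abel
  smul_mem' := by
    rintro c x ⟨y, hy⟩
    refine ⟨c • y, (hy.const_smul c).congr fun t => ?_⟩
    rw [smul_comm, map_smul, smul_sub]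

/-- Applying `S h - 1` to the integral over `(0, t)` leaves the integral over `(t, t + h)` minus
that over `(0, h)`. -/
theorem integral_mem_diffDomain [CompleteSpace H] (hS : IsC0Semigroup S) (x : H) {t : ℝ}
    (ht : 0 ≤ t) : ∫ s in (0 : ℝ)..t, S (max s 0) x ∈ diffDomain S := by
  have hg := hS.continuous_max x
  have hd : ∀ r, HasDerivAt (fun r => ∫ s in (0 : ℝ)..r, S (max s 0) x) (S (max r 0) x) r :=
    fun r => intervalIntegral.integral_hasDerivAt_right (hg.intervalIntegrable _ _)
      hg.stronglyMeasurable.stronglyMeasurableAtFilter hg.continuousAt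
  have h1 := (hasDerivAt_iff_tendsto_slope_zero.1 (hd t)).mono_left
    (nhdsWithin_mono _ (fun h (hh : h ∈ Ioi (0 : ℝ)) => ne_of_gt hh))
  have h2 := (hasDerivAt_iff_tendsto_slope_zero.1 (hd 0)).mono_left
    (nhdsWithin_mono _ (fun h (hh : h ∈ Ioi (0 : ℝ)) => ne_of_gt hh))
  refine ⟨_, (h1.sub h2).congr' ?_⟩
  filter_upwards [self_mem_nhdsWithin] with h hh
  have hh : 0 < h := hh
  have e1 : S h (∫ s in (0 : ℝ)..t, S (max s 0) x) = ∫ s in (0 : ℝ)..t, S (max (s + h) 0) x := by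
    rw [← ContinuousLinearMap.intervalIntegral_comp_comm _ (hg.intervalIntegrable _ _)]
    refine intervalIntegral.integral_congr fun s hs => ?_
    rw [uIcc_of_le ht] at hs
    rw [← hS.apply_add hh.le (le_max_right _ _), max_eq_left hs.1,
      max_eq_left (add_nonneg hs.1 hh.le), add_comm]
  have e2 : ((h : ℂ)⁻¹) = ((h⁻¹ : ℝ) : ℂ) := by simp
  rw [e1, intervalIntegral.integral_comp_add_right (fun s => S (max s 0) x), e2,
    Complex.coe_smul, ← smul_sub]
  congr 1
  have e3 := intervalIntegral.integral_add_adjacent_intervals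
    (hg.intervalIntegrable (μ := volume) 0 h) (hg.intervalIntegrable h (t + h))
  simp only [zero_add, intervalIntegral.integral_same]
  rw [← e3]
  abel

theorem dense_diffDomain [CompleteSpace H] (hS : IsC0Semigroup S) :
    Dense (diffDomain S : Set H) := by
  intro x
  have hg := hS.continuous_max x
  have hd : HasDerivAt (fun r => ∫ s in (0 : ℝ)..r, S (max s 0) x) (S (max 0 0) x) 0 :=
    intervalIntegral.integral_hasDerivAt_right (hg.intervalIntegrable _ _)
      hg.stronglyMeasurable.stronglyMeasurableAtFilter hg.continuousAt
  have h2 := (hasDerivAt_iff_tendsto_slope_zero.1 hd).mono_left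
    (nhdsWithin_mono _ (fun h (hh : h ∈ Ioi (0 : ℝ)) => ne_of_gt hh))
  simp only [max_self, hS.map_zero, ContinuousLinearMap.id_apply, zero_add,
    intervalIntegral.integral_same, sub_zero] at h2
  refine mem_closure_of_tendsto h2 ?_
  filter_upwards [self_mem_nhdsWithin] with h hh
  have := (diffDomain S).smul_mem ((h⁻¹ : ℝ) : ℂ) (hS.integral_mem_diffDomain x (le_of_lt hh))
  rwa [Complex.coe_smul] at this

theorem diffDomain_eq_top [FiniteDimensional ℂ H] (hS : IsC0Semigroup S) :
    diffDomain S = ⊤ := by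
  have : CompleteSpace H := FiniteDimensional.complete ℂ H
  have h := (diffDomain S).closed_of_finiteDimensional.closure_eq
  rw [hS.dense_diffDomain.closure_eq] at h
  exact SetLike.coe_injective h.symm

/-- In finite dimension, weak continuity of the orbits is enough. -/
theorem of_inner [FiniteDimensional ℂ H] (h0 : S 0 = ContinuousLinearMap.id ℂ H)
    (hadd : ∀ s t : ℝ, 0 ≤ s → 0 ≤ t → S (s + t) = (S s).comp (S t))
    (hc : ∀ x y : H, ContinuousOn (fun t : ℝ => inner ℂ y (S t x)) (Ici 0)) :
    IsC0Semigroup S := by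
  refine ⟨h0, hadd, fun x => ?_⟩
  have h : (fun t : ℝ => S t x) =
      fun t => ∑ i, inner ℂ (stdOrthonormalBasis ℂ H i) (S t x) • stdOrthonormalBasis ℂ H i :=
    funext fun t => ((stdOrthonormalBasis ℂ H).sum_repr' (S t x)).symm
  rw [h]
  exact continuousOn_finsetSum _ fun i _ => (hc x _).smul continuousOn_const

theorem pow_mem (hS : IsC0Semigroup S) {N : Set H} {a : ℝ} (ha : 0 ≤ a)
    (h : ∀ x ∈ N, S a x ∈ N) (n : ℕ) : ∀ x ∈ N, S (n * a) x ∈ N := by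
  induction n with
  | zero => intro x hx; simpa [hS.map_zero] using hx
  | succ n ih =>
    intro x hx
    have e : ((n + 1 : ℕ) : ℝ) * a = n * a + a := by push_cast; ring
    rw [e, hS.apply_add (by positivity) ha]
    exact ih _ (h x hx)

theorem mem_of_forall_lt (hS : IsC0Semigroup S) {N : Set H} {δ : ℝ} (hδ : 0 < δ)
    (h : ∀ a, 0 < a → a < δ → ∀ x ∈ N, S a x ∈ N) {t : ℝ} (ht : 0 ≤ t) {x : H} (hx : x ∈ N) :
    S t x ∈ N := by
  rcases ht.eq_or_lt with rfl | ht
  · simpa [hS.map_zero] using hx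
  obtain ⟨n, hn⟩ := exists_nat_gt (t / δ)
  have hn0 : (0 : ℝ) < n := (div_pos ht hδ).trans hn
  have hlt : t / n < δ := by
    rw [div_lt_iff₀ hn0, mul_comm]; exact (div_lt_iff₀ hδ).1 hn
  have := hS.pow_mem (div_pos ht hn0).le (h _ (div_pos ht hn0) hlt) n x hx
  rwa [mul_div_cancel₀ _ hn0.ne'] at this

end IsC0Semigroup

/-! ### Input map and reachable spaces -/

theorem MeasureTheory.Lp.exists_integral_norm_le {α E : Type*} [MeasurableSpace α]
    [NormedAddCommGroup E] (μ : Measure α) [IsFiniteMeasure μ] :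
    ∃ C : ℝ, 0 ≤ C ∧ ∀ u : Lp E 2 μ, ∫ x, ‖u x‖ ∂μ ≤ C * ‖u‖ := by
  refine ⟨(μ univ ^ (1 / (1 : ENNReal).toReal - 1 / (2 : ENNReal).toReal)).toReal,
    ENNReal.toReal_nonneg, fun u => ?_⟩
  rw [integral_norm_eq_lintegral_enorm (Lp.aestronglyMeasurable u), Lp.norm_def, mul_comm,
    ← ENNReal.toReal_mul, ← eLpNorm_one_eq_lintegral_enorm]
  refine ENNReal.toReal_mono (ENNReal.mul_ne_top (Lp.eLpNorm_ne_top u) ?_)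
    (eLpNorm_le_eLpNorm_mul_rpow_measure_univ one_le_two (Lp.aestronglyMeasurable u))
  exact ENNReal.rpow_ne_top_of_nonneg (by norm_num) (measure_ne_top _ _)

theorem integrableOn_control {U : Type*} [NormedAddCommGroup U] {T : ℝ} (u : L2Control U T) : IntegrableOn u (Ioo 0 T) :=
  (Lp.memLp u).integrable one_le_two

namespace IsC0Semigroup

variable {S : ℝ → H →L[ℂ] H} {U : Type*} [NormedAddCommGroup U] [InnerProductSpace ℂ U]

theorem integrable_duhamel [CompleteSpace H] (hS : IsC0Semigroup S) (B : U →L[ℂ] H) (T : ℝ)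
    {u : ℝ → U} (hu : IntegrableOn u (Ioo 0 T)) :
    IntegrableOn (fun s => S (T - s) (B (u s))) (Ioo 0 T) := by
  obtain ⟨M, hM0, hM⟩ := hS.exists_norm_le T
  have hm : AEStronglyMeasurable (fun s => S (max (T - s) 0) (B (u s)))
      (volume.restrict (Ioo 0 T)) :=
    hS.continuous_uncurry.comp_aestronglyMeasurable
      (AEStronglyMeasurable.prodMk (by fun_prop)
        (B.continuous.comp_aestronglyMeasurable hu.aestronglyMeasurable))
  have hi : IntegrableOn (fun s => S (max (T - s) 0) (B (u s))) (Ioo 0 T) := by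
    refine Integrable.mono' (hu.norm.const_mul (M * ‖B‖)) hm ?_
    filter_upwards [ae_restrict_mem measurableSet_Ioo] with s hs
    calc _ ≤ M * ‖B (u s)‖ := (S _).le_of_opNorm_le (hM _ (by linarith [hs.1])) _
      _ ≤ M * (‖B‖ * ‖u s‖) := by gcongr; exact B.le_opNorm _
      _ = _ := by ring
  refine hi.congr_fun (fun s hs => ?_) measurableSet_Ioo
  simp only [max_eq_left (show 0 ≤ T - s by linarith [hs.2])]

/-- The input map: the state reached at time `T` from `0` with the control `u`. -/
def inputMap [CompleteSpace H] (hS : IsC0Semigroup S) (B : U →L[ℂ] H) (T : ℝ) :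
    L2Control U T →L[ℂ] H :=
  LinearMap.mkContinuousOfExistsBound
    { toFun := fun u => ∫ s in Ioo 0 T, S (T - s) (B (u s))
      map_add' := fun u v => by
        rw [← integral_add (hS.integrable_duhamel B T (integrableOn_control u))
          (hS.integrable_duhamel B T (integrableOn_control v))]
        refine integral_congr_ae ?_
        filter_upwards [Lp.coeFn_add u v] with s hs
        rw [hs, Pi.add_apply, _root_.map_add, _root_.map_add]
      map_smul' := fun c u => by
        rw [RingHom.id_apply, ← integral_smul]
        refine integral_congr_ae ?_
        filter_upwards [Lp.coeFn_smul c u] with s hs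
        rw [hs, Pi.smul_apply, map_smul, map_smul] }
    (by
      obtain ⟨M, hM0, hM⟩ := hS.exists_norm_le T
      obtain ⟨C, hC0, hC⟩ := Lp.exists_integral_norm_le (E := U) (volume.restrict (Ioo 0 T))
      refine ⟨M * ‖B‖ * C, fun u => ?_⟩
      have hi := integrableOn_control u
      calc _ ≤ ∫ s in Ioo 0 T, M * ‖B‖ * ‖u s‖ := by
            refine norm_integral_le_of_norm_le (hi.norm.const_mul _) ?_
            filter_upwards [ae_restrict_mem measurableSet_Ioo] with s hs
            have h1 := hM (T - s) (by linarith [hs.1])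
            rw [max_eq_left (by linarith [hs.2])] at h1
            calc _ ≤ M * ‖B (u s)‖ := (S _).le_of_opNorm_le h1 _
              _ ≤ M * (‖B‖ * ‖u s‖) := by gcongr; exact B.le_opNorm _
              _ = _ := by ring
        _ = M * ‖B‖ * ∫ s in Ioo 0 T, ‖u s‖ := integral_const_mul _ _
        _ ≤ M * ‖B‖ * (C * ‖u‖) := by gcongr; exact hC u
        _ = _ := by ring)

theorem inputMap_apply [CompleteSpace H] (hS : IsC0Semigroup S) (B : U →L[ℂ] H) (T : ℝ)
    (u : L2Control U T) : hS.inputMap B T u = ∫ s in Ioo 0 T, S (T - s) (B (u s)) := rfl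

theorem mildSolution_eq [CompleteSpace H] (hS : IsC0Semigroup S) (B : U →L[ℂ] H) {T : ℝ}
    (hT : 0 ≤ T) (f : H) (u : L2Control U T) :
    mildSolution S B f u T = S T f + hS.inputMap B T u := by
  rw [mildSolution, inputMap_apply, intervalIntegral.integral_of_le hT,
    integral_Ioc_eq_integral_Ioo]

theorem inputMap_extend [CompleteSpace H] (hS : IsC0Semigroup S) (B : U →L[ℂ] H) {T a b : ℝ}
    (hT : 0 ≤ T) (ha : 0 ≤ a) (hb : 0 ≤ b) (u : L2Control U T) (v : L2Control U (T + a + b))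
    (h : (v : ℝ → U) =ᵐ[volume.restrict (Ioo (0 : ℝ) (T + a + b))]
        (Ioo a (T + a)).indicator (fun t => (u : ℝ → U) (t - a))) :
    hS.inputMap B (T + a + b) v = S b (hS.inputMap B T u) := by
  have e1 : hS.inputMap B (T + a + b) v = ∫ s in Ioo 0 (T + a + b), (Ioo a (T + a)).indicator
      (fun s => S (T + a + b - s) (B (u (s - a)))) s := by
    rw [inputMap_apply]
    refine integral_congr_ae ?_
    filter_upwards [h] with s hs
    rw [hs]
    by_cases hm : s ∈ Ioo a (T + a)
    · simp [hm]
    · simp [hm]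
  rw [e1, setIntegral_indicator measurableSet_Ioo,
    inter_eq_right.2 (Ioo_subset_Ioo ha (by linarith)), inputMap_apply,
    ← ContinuousLinearMap.integral_comp_comm _
      (hS.integrable_duhamel B T (integrableOn_control u)),
    ← integral_Ioc_eq_integral_Ioo, ← integral_Ioc_eq_integral_Ioo,
    ← intervalIntegral.integral_of_le (by linarith), ← intervalIntegral.integral_of_le hT]
  have e2 := intervalIntegral.integral_comp_sub_right (a := a) (b := T + a)
    (fun s => S b (S (T - s) (B (u s)))) a
  rw [sub_self, add_sub_cancel_right] at e2
  rw [← e2]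
  refine intervalIntegral.integral_congr fun s hs => ?_
  rw [uIcc_of_le (by linarith)] at hs
  rw [← hS.apply_add hb (by linarith [hs.2])]
  congr 2
  ring

/-- The states that can be reached at time `T` from `0` with controls in the range of `ι`. -/
def reach [CompleteSpace H] (hS : IsC0Semigroup S) (B : U →L[ℂ] H) {T : ℝ} {V : Type*}
    [NormedAddCommGroup V] [InnerProductSpace ℂ V] (ι : V →L[ℂ] L2Control U T) :
    Submodule ℂ H :=
  LinearMap.range ((hS.inputMap B T).comp ι : V →ₗ[ℂ] H)

theorem mem_reach [CompleteSpace H] (hS : IsC0Semigroup S) (B : U →L[ℂ] H) {T : ℝ} {V : Type*}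
    [NormedAddCommGroup V] [InnerProductSpace ℂ V] (ι : V →L[ℂ] L2Control U T) (x : H) :
    x ∈ hS.reach B ι ↔ ∃ u : V, hS.inputMap B T (ι u) = x := Iff.rfl

theorem mildSolution_eq_zero_iff [CompleteSpace H] (hS : IsC0Semigroup S) (B : U →L[ℂ] H) {T : ℝ}
    (hT : 0 ≤ T) {V : Type*} [NormedAddCommGroup V] [InnerProductSpace ℂ V]
    (ι : V →L[ℂ] L2Control U T) (f : H) :
    (∃ u : V, mildSolution S B f (ι u) T = 0) ↔ S T f ∈ hS.reach B ι := by
  rw [← neg_mem_iff, mem_reach]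
  refine exists_congr fun u => ?_
  rw [hS.mildSolution_eq B hT, add_comm, add_eq_zero_iff_eq_neg]

/-- The space is the projection to `H` of the closed set of pairs `(x, u)` where `S T x` is the
state reached by `u`, hence the range of a bounded operator between complete spaces. -/
theorem isClosed_comap_reach [CompleteSpace H] (hS : IsC0Semigroup S) (B : U →L[ℂ] H) {T : ℝ}
    {V : Type*} [NormedAddCommGroup V] [InnerProductSpace ℂ V] [CompleteSpace V]
    (ι : V →L[ℂ] L2Control U T)
    (hfin : FiniteDimensional ℂ (H ⧸ (hS.reach B ι).comap (S T : H →ₗ[ℂ] H))) :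
    IsClosed ((hS.reach B ι).comap (S T : H →ₗ[ℂ] H) : Set H) := by
  let g : H × V →L[ℂ] H := (S T).coprod (-(hS.inputMap B T).comp ι)
  let K : Submodule ℂ (H × V) := LinearMap.ker (g : H × V →ₗ[ℂ] H)
  have : CompleteSpace K := (ContinuousLinearMap.isClosed_ker g).completeSpace_coe
  let p : K →L[ℂ] H := (ContinuousLinearMap.fst ℂ H V).comp K.subtypeL
  have hp : LinearMap.range (p : K →ₗ[ℂ] H) = (hS.reach B ι).comap (S T : H →ₗ[ℂ] H) := by
    ext x
    constructor
    · rintro ⟨⟨⟨y, u⟩, hk⟩, rfl⟩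
      have hk : S T y + -(hS.inputMap B T (ι u)) = 0 := hk
      exact ⟨u, (add_neg_eq_zero.1 hk).symm⟩
    · rintro ⟨u, hu⟩
      exact ⟨⟨(x, u), add_neg_eq_zero.2 hu.symm⟩, rfl⟩
  have := p.isClosed_range_of_finite_quotient (by rwa [hp])
  rw [← hp]
  exact this

end IsC0Semigroup

/-! ### Stationarity of the null-controllable space -/

namespace IsC0Semigroup

variable {S : ℝ → H →L[ℂ] H}

theorem exists_stable_subspace (hS : IsC0Semigroup S) (R : ℝ → Submodule ℂ H)
    (hR : ∀ t b t' : ℝ, 0 < t → 0 < b → t + b < t' → ∀ x ∈ R t, S b x ∈ R t')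
    {T₀ T : ℝ} (hT₀ : 0 < T₀) (hT : T₀ < T)
    (hfin : FiniteDimensional ℂ (H ⧸ (R T₀).comap (S T₀ : H →ₗ[ℂ] H)))
    (hcl : ∀ t, FiniteDimensional ℂ (H ⧸ (R t).comap (S t : H →ₗ[ℂ] H)) →
      IsClosed ((R t).comap (S t : H →ₗ[ℂ] H) : Set H)) :
    ∃ N : Submodule ℂ H, ∃ δ : ℝ, 0 < δ ∧ IsClosed (N : Set H) ∧ FiniteDimensional ℂ (H ⧸ N) ∧
      (∀ a, 0 < a → a < δ → ∀ x ∈ N, S a x ∈ N) ∧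
      (∀ s, 0 < s → s < δ → R s ≤ N) ∧
      (N = ⊤ → ∀ x, S T x ∈ R T) := by
  set N : ℝ → Submodule ℂ H := fun t => (R t).comap (S t : H →ₗ[ℂ] H) with hN
  have hNm : ∀ t x, x ∈ N t ↔ S t x ∈ R t := fun t x => Iff.rfl
  have hstep : ∀ t a t', 0 < t → 0 < a → t + a < t' →
      (N t).comap (S a : H →ₗ[ℂ] H) ≤ N t' := by
    intro t a t' ht ha h x hx
    have hx : S t (S a x) ∈ R t := hx
    have h1 := hR t (t' - t - a) t' ht (by linarith) (by linarith) _ hx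
    -- Evolve freely for time `a`, use the control for time `t`, then evolve freely until `t'`.
    rw [← hS.apply_add ht.le ha.le, ← hS.apply_add (by linarith) (by linarith)] at h1
    rw [hNm]
    convert h1 using 2
    congr 1
    ring
  have hmono : ∀ t t', 0 < t → t < t' → FiniteDimensional ℂ (H ⧸ N t) →
      FiniteDimensional ℂ (H ⧸ N t') ∧
        Module.finrank ℂ (H ⧸ N t') ≤ Module.finrank ℂ (H ⧸ N t) := by
    intro t t' ht htt h
    have h1 := Submodule.finite_quotient_comap (S ((t' - t) / 2) : H →ₗ[ℂ] H) (N t)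
    have := h1.1
    have h2 := Submodule.finrank_quotient_anti
      (hstep t ((t' - t) / 2) t' ht (by linarith) (by linarith))
    exact ⟨h2.1, h2.2.trans h1.2⟩
  have hfin' : ∀ t, T₀ < t → FiniteDimensional ℂ (H ⧸ N t) := fun t ht =>
    (hmono T₀ t hT₀ ht hfin).1
  obtain ⟨n, ⟨T₁, hT₁, hT₁n⟩, hmin⟩ : ∃ n, (∃ t ∈ Ioo T₀ T, Module.finrank ℂ (H ⧸ N t) = n) ∧
      ∀ m, (∃ t ∈ Ioo T₀ T, Module.finrank ℂ (H ⧸ N t) = m) → n ≤ m := by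
    classical
    have hex : ∃ n, ∃ t ∈ Ioo T₀ T, Module.finrank ℂ (H ⧸ N t) = n :=
      ⟨_, (T₀ + T) / 2, ⟨by linarith, by linarith⟩, rfl⟩
    exact ⟨Nat.find hex, Nat.find_spec hex, fun m hm => Nat.find_min' hex hm⟩
  have hT₁0 : 0 < T₁ := hT₀.trans hT₁.1
  have := hfin' T₁ hT₁.1
  have hcomap : ∀ a t, 0 < a → T₁ + a < t → t < T →
      (N T₁).comap (S a : H →ₗ[ℂ] H) = N t ∧
      Module.finrank ℂ (H ⧸ (N T₁).comap (S a : H →ₗ[ℂ] H)) = Module.finrank ℂ (H ⧸ N T₁) := by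
    intro a t ha hat htT
    have h1 := Submodule.finite_quotient_comap (S a : H →ₗ[ℂ] H) (N T₁)
    have := h1.1
    have h2 := hstep T₁ a t hT₁0 ha hat
    have h3 : n ≤ Module.finrank ℂ (H ⧸ N t) :=
      hmin _ ⟨t, ⟨by linarith [hT₁.1], htT⟩, rfl⟩
    -- The preimage has codimension at most the minimum `n`, while the larger space `N t` has
    -- codimension at least `n`.
    have h4 := Submodule.eq_of_le_of_finrank_quotient_le h2 (by linarith)
    refine ⟨h4, le_antisymm h1.2 ?_⟩
    rw [h4]; linarith
  have hclosed : IsClosed (N T₁ : Set H) := hcl T₁ (hfin' T₁ hT₁.1)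
  have hconst : ∀ t, T₁ < t → t < T → N t = N T₁ := by
    intro t ht htT
    -- For `x ∈ N t`, `S a x ∈ N T₁` for all small `a > 0`; let `a → 0` and use closedness.
    have hle : N t ≤ N T₁ := by
      intro x hx
      refine hclosed.mem_of_tendsto (hS.tendsto_zero x) ?_
      filter_upwards [Ioo_mem_nhdsGT (show (0 : ℝ) < t - T₁ by linarith)] with a ha
      have h1 := (hcomap a t ha.1 (by linarith [ha.2]) htT).1
      rw [← h1] at hx
      exact hx
    have := hfin' t (hT₁.1.trans ht)
    exact Submodule.eq_of_le_of_finrank_quotient_le hle (hmono T₁ t hT₁0 ht (hfin' T₁ hT₁.1)).2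
  have hiff : ∀ a, 0 < a → a < T - T₁ → ∀ x, S a x ∈ N T₁ ↔ x ∈ N T₁ := by
    intro a ha haT x
    have h1 := (hcomap a ((T₁ + a + T) / 2) ha (by linarith) (by linarith)).1
    have h2 := hconst ((T₁ + a + T) / 2) (by linarith) (by linarith)
    rw [h2] at h1
    exact SetLike.ext_iff.1 h1 x
  refine ⟨N T₁, (T - T₁) / 4, by linarith [hT₁.2], hclosed, hfin' T₁ hT₁.1,
    fun a ha haT x hx => (hiff a ha (by linarith) x).2 hx, ?_, ?_⟩
  · intro s hs hsT r hr
    set d : ℝ := (T - T₁) / 4 with hd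
    have hd0 : 0 < d := by linarith
    -- Equal codimensions make `S (2d)` onto modulo `N`, so `-S d r` can be replaced by some `S (2d)
    -- x`. Evolving to time `T₁ + 3d`, the contribution of `r` is reachable because `s < d`, which
    -- forces `x ∈ N` and then `r ∈ N`. The quarter in `d` keeps `T₁ + 3d < T`.
    have hsurj := Submodule.surjective_mod_of_finrank_comap (S (d + d) : H →ₗ[ℂ] H) (N T₁)
      (hcomap (d + d) (T₁ + d + d + d / 2) (by linarith) (by linarith) (by linarith)).2
      (-S d r)
    obtain ⟨x, hx⟩ := hsurj
    have hx : S (d + d) x - -S d r ∈ N T₁ := hx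
    rw [sub_neg_eq_add] at hx
    have hx' : S T₁ (S (d + d) x + S d r) ∈ R T₁ := hx
    have h1 := hR T₁ d (T₁ + 3 * d) hT₁0 hd0 (by linarith) _ hx'
    have h2 := hR s (d + T₁ + d) (T₁ + 3 * d) hs (by linarith) (by linarith) _ hr
    have e1 : S d (S T₁ (S (d + d) x + S d r)) = S (T₁ + 3 * d) x + S (d + T₁ + d) r := by
      rw [_root_.map_add, _root_.map_add, ← hS.apply_add hT₁0.le (by linarith),
        ← hS.apply_add hT₁0.le hd0.le, ← hS.apply_add hd0.le (by linarith),
        ← hS.apply_add hd0.le (by linarith), ← add_assoc d T₁ d,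
        show d + (T₁ + (d + d)) = T₁ + 3 * d by ring]
    rw [e1] at h1
    have hxN : x ∈ N T₁ := by
      rw [← hconst (T₁ + 3 * d) (by linarith) (by linarith [hT₁.2]), hNm]
      exact (Submodule.add_mem_iff_left _ h2).1 h1
    have hxd := (hiff (d + d) (by linarith) (by linarith) x).2 hxN
    exact (hiff d hd0 (by linarith) r).1 ((Submodule.add_mem_iff_right _ hxd).1 hx)
  · intro htop x
    have h1 := hstep T₁ ((T - T₁) / 2) T hT₁0 (by linarith [hT₁.2]) (by linarith [hT₁.2])
    rw [htop] at h1
    exact h1 trivial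

end IsC0Semigroup

/-! ### Adjoint semigroup, generalized eigenvectors and observation -/

theorem le_genEigenSpan_of_invariant (A : H →ₗ.[ℂ] H) (W : Submodule ℂ H)
    [FiniteDimensional ℂ W] (hdom : W ≤ A.domain)
    (hmap : ∀ w (hw : w ∈ W), A ⟨w, hdom hw⟩ ∈ W) : W ≤ genEigenSpan A := by
  let f : Module.End ℂ W :=
    { toFun := fun w => ⟨A ⟨w, hdom w.2⟩, hmap w w.2⟩
      map_add' := fun v w => Subtype.ext (A.map_add ⟨v, hdom v.2⟩ ⟨w, hdom w.2⟩)
      map_smul' := fun c w => Subtype.ext (A.map_smul c ⟨w, hdom w.2⟩) }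
  have hker : ∀ (μ : ℂ) (k : ℕ) (w : W), ((f - algebraMap ℂ _ μ) ^ k) w = 0 →
      InKerPow A μ k (w : H) := by
    intro μ k
    induction k with
    | zero => intro w hw; simpa [InKerPow] using hw
    | succ k ih =>
      intro w hw
      rw [pow_succ, Module.End.mul_apply] at hw
      exact ⟨hdom w.2, ih _ hw⟩
  have htop : (⊤ : Submodule ℂ W) ≤ (genEigenSpan A).comap W.subtype := by
    rw [← Module.End.iSup_maxGenEigenspace_eq_top f]
    refine iSup_le fun μ w hw => ?_
    obtain ⟨k, hk⟩ := (Module.End.mem_maxGenEigenspace f μ w).1 hw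
    exact Submodule.subset_span ⟨μ, k, hker μ k w hk⟩
  exact fun w hw => htop (x := ⟨w, hw⟩) trivial

theorem Generates.dense_domain [CompleteSpace H] {A : H →ₗ.[ℂ] H} {S : ℝ → H →L[ℂ] H}
    (h : Generates A S) : Dense (A.domain : Set H) := by
  convert h.isC0Semigroup.dense_diffDomain
  ext x
  rw [LinearPMap.mem_domain_iff]
  exact exists_congr fun y => h.mem_graph_iff x y

namespace IsC0Semigroup

open ContinuousLinearMap

variable {S : ℝ → H →L[ℂ] H} [CompleteSpace H]

/-- The restriction of the adjoint semigroup to a subspace invariant under it. -/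
def adjointRestrict (S : ℝ → H →L[ℂ] H) (W : Submodule ℂ H)
    (hW : ∀ t, 0 ≤ t → ∀ w ∈ W, adjoint (S t) w ∈ W) (t : ℝ) : W →L[ℂ] W :=
  ((adjoint (S (max t 0))).comp W.subtypeL).codRestrict W
    fun w => hW _ (le_max_right _ _) w w.2

theorem adjointRestrict_coe {W : Submodule ℂ H}
    (hW : ∀ t, 0 ≤ t → ∀ w ∈ W, adjoint (S t) w ∈ W) {t : ℝ} (ht : 0 ≤ t) (w : W) :
    (adjointRestrict S W hW t w : H) = adjoint (S t) w := by
  change adjoint (S (max t 0)) (w : H) = _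
  rw [max_eq_left ht]

/-- Strong continuity of `S` gives only weak continuity of the adjoint orbits, which suffices on the
finite-dimensional `W`. -/
theorem isC0Semigroup_adjointRestrict (hS : IsC0Semigroup S) {W : Submodule ℂ H}
    [FiniteDimensional ℂ W] (hW : ∀ t, 0 ≤ t → ∀ w ∈ W, adjoint (S t) w ∈ W) :
    IsC0Semigroup (adjointRestrict S W hW) := by
  refine of_inner ?_ ?_ ?_
  · ext w
    rw [adjointRestrict_coe hW le_rfl, hS.map_zero]
    exact congrArg (fun f : H →L[ℂ] H => f w) adjoint_id
  · intro s t hs ht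
    ext w
    rw [comp_apply, adjointRestrict_coe hW (add_nonneg hs ht), adjointRestrict_coe hW hs,
      adjointRestrict_coe hW ht, add_comm, hS.map_add t s ht hs, adjoint_comp]
    rfl
  · intro w v
    have h : ContinuousOn (fun t : ℝ => inner ℂ (S t (v : H)) (w : H)) (Ici 0) :=
      (hS.continuousOn v).inner continuousOn_const
    refine h.congr fun t ht => ?_
    rw [Submodule.coe_inner, adjointRestrict_coe hW ht, adjoint_inner_right]

theorem continuous_adjoint_max (hS : IsC0Semigroup S) {W : Submodule ℂ H}
    [FiniteDimensional ℂ W] (hW : ∀ t, 0 ≤ t → ∀ w ∈ W, adjoint (S t) w ∈ W) {w : H}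
    (hw : w ∈ W) : Continuous fun t : ℝ => adjoint (S (max t 0)) w := by
  refine (continuous_subtype_val.comp
    ((hS.isC0Semigroup_adjointRestrict hW).continuous_max ⟨w, hw⟩)).congr fun t => ?_
  exact adjointRestrict_coe hW (le_max_right _ _) _

theorem exists_adjoint_generator {A : H →ₗ.[ℂ] H} (hAS : Generates A S) {W : Submodule ℂ H}
    [FiniteDimensional ℂ W] (hW : ∀ t, 0 ≤ t → ∀ w ∈ W, adjoint (S t) w ∈ W) {w : H}
    (hw : w ∈ W) : ∃ y ∈ W, ∀ x : A.domain, inner ℂ y (x : H) = inner ℂ w (A x) := by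
  have hE := hAS.isC0Semigroup.isC0Semigroup_adjointRestrict hW
  have hmem : (⟨w, hw⟩ : W) ∈ diffDomain (adjointRestrict S W hW) := by
    rw [hE.diffDomain_eq_top]; trivial
  obtain ⟨y, hy⟩ := hmem
  refine ⟨y, y.2, fun x => ?_⟩
  have h1 := (hAS.mem_graph_iff _ _).1 (A.mem_graph x)
  have h2 : Tendsto (fun t : ℝ => inner ℂ w ((t : ℂ)⁻¹ • (S t (x : H) - x))) (𝓝[>] 0)
      (𝓝 (inner ℂ w (A x))) := tendsto_const_nhds.inner h1
  have h3 : Tendsto (fun t : ℝ => inner ℂ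
      (((t : ℂ)⁻¹ • (adjointRestrict S W hW t ⟨w, hw⟩ - ⟨w, hw⟩) : W) : H) (x : H)) (𝓝[>] 0)
      (𝓝 (inner ℂ (y : H) (x : H))) :=
    ((continuous_subtype_val.tendsto y).comp hy).inner tendsto_const_nhds
  refine tendsto_nhds_unique (h3.congr' ?_) h2
  filter_upwards [self_mem_nhdsWithin] with t ht
  rw [Submodule.coe_smul, Submodule.coe_sub, adjointRestrict_coe hW (le_of_lt ht),
    inner_smul_left, inner_smul_right, inner_sub_left, inner_sub_right, adjoint_inner_left]
  simp

theorem le_genEigenSpan_adjoint {A : H →ₗ.[ℂ] H} (hAS : Generates A S) {W : Submodule ℂ H}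
    [FiniteDimensional ℂ W] (hW : ∀ t, 0 ≤ t → ∀ w ∈ W, adjoint (S t) w ∈ W) :
    W ≤ genEigenSpan A.adjoint := by
  have hdom : W ≤ A.adjoint.domain := fun w hw => by
    obtain ⟨y, -, hy⟩ := exists_adjoint_generator hAS hW hw
    exact A.mem_adjoint_domain_of_exists w ⟨y, hy⟩
  refine le_genEigenSpan_of_invariant _ W hdom fun w hw => ?_
  obtain ⟨y, hyW, hy⟩ := exists_adjoint_generator hAS hW hw
  rw [A.adjoint_apply_eq hAS.dense_domain ⟨w, hdom hw⟩ hy]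
  exact hyW

theorem adjoint_invariant_orthogonal {N : Submodule ℂ H} {t : ℝ} (h : ∀ x ∈ N, S t x ∈ N) :
    ∀ w ∈ Nᗮ, adjoint (S t) w ∈ Nᗮ := by
  intro w hw x hx
  rw [adjoint_inner_right]
  exact hw _ (h x hx)

variable {U : Type*} [NormedAddCommGroup U] [InnerProductSpace ℂ U] [CompleteSpace U]

/-- By density, `w` is orthogonal to the states reached by all `L²` controls. Testing with the
observation `φ` itself gives `∫ ‖φ‖² = 0`, and `φ` is continuous. -/
theorem observation_eq_zero (hS : IsC0Semigroup S) (B : U →L[ℂ] H) {W : Submodule ℂ H}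
    [FiniteDimensional ℂ W] (hW : ∀ t, 0 ≤ t → ∀ w ∈ W, adjoint (S t) w ∈ W) {w : H}
    (hw : w ∈ W) {s : ℝ} {V : Type*} [NormedAddCommGroup V] [InnerProductSpace ℂ V]
    (ι : V →L[ℂ] L2Control U s) (hι : DenseRange ι) (hR : ∀ x ∈ hS.reach B ι, inner ℂ w x = 0) :
    ∀ t ∈ Ioo 0 s, adjoint B (adjoint (S t) w) = 0 := by
  have hzero : ∀ u : L2Control U s, inner ℂ w (hS.inputMap B s u) = 0 := by
    intro u
    refine hι.induction_on (p := fun u => inner ℂ w (hS.inputMap B s u) = 0) u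
      (isClosed_eq (by fun_prop) continuous_const) fun v => hR _ ⟨v, rfl⟩
  let φ : ℝ → U := fun τ => adjoint B (adjoint (S (max (s - τ) 0)) w)
  have hφ : Continuous φ := (adjoint B).continuous.comp
    ((hS.continuous_adjoint_max hW hw).comp (continuous_const.sub continuous_id))
  obtain ⟨C, hC⟩ := isCompact_Icc.exists_bound_of_continuousOn
    (s := Icc (0 : ℝ) s) hφ.continuousOn
  have hmem : MemLp φ 2 (volume.restrict (Ioo 0 s)) := by
    refine MemLp.of_bound hφ.aestronglyMeasurable C ?_
    filter_upwards [ae_restrict_mem measurableSet_Ioo] with τ hτ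
    exact hC τ ⟨hτ.1.le, hτ.2.le⟩
  have hi : IntegrableOn (fun τ => S (s - τ) (B (φ τ))) (Ioo 0 s) :=
    hS.integrable_duhamel B s (hmem.integrable one_le_two)
  have h1 : hS.inputMap B s (hmem.toLp φ) = ∫ τ in Ioo 0 s, S (s - τ) (B (φ τ)) := by
    rw [inputMap_apply]
    refine integral_congr_ae ?_
    filter_upwards [hmem.coeFn_toLp] with τ hτ
    rw [hτ]
  have h2 := hzero (hmem.toLp φ)
  have h3 : (fun τ => inner ℂ w (S (max (s - τ) 0) (B (φ τ)))) = fun τ => ((‖φ τ‖ ^ 2 : ℝ) : ℂ) := by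
    funext τ
    rw [← adjoint_inner_left, ← adjoint_inner_left, inner_self_eq_norm_sq_to_K]
    simp [φ]
  have h4 : ∫ τ in Ioo 0 s, ‖φ τ‖ ^ 2 = 0 := by
    rw [h1, ← integral_inner hi] at h2
    rw [← Complex.ofReal_eq_zero, ← integral_complex_ofReal, ← h2]
    refine setIntegral_congr_fun measurableSet_Ioo fun τ hτ => ?_
    have := congrFun h3 τ
    rw [max_eq_left (by linarith [hτ.2])] at this
    exact this.symm
  have h5 := (setIntegral_eq_zero_iff_of_nonneg_ae (.of_forall fun τ => sq_nonneg ‖φ τ‖)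
    (hmem.integrable_norm_pow two_ne_zero)).1 h4
  have h6 : φ =ᵐ[volume.restrict (Ioo 0 s)] fun _ => 0 := by
    filter_upwards [h5] with τ hτ
    simpa using hτ
  have h7 := Measure.eqOn_open_of_ae_eq h6 isOpen_Ioo hφ.continuousOn continuousOn_const
  intro t ht
  have h8 := h7 (show s - t ∈ Ioo 0 s from ⟨by linarith [ht.2], by linarith [ht.1]⟩)
  simpa only [φ, sub_sub_cancel, max_eq_left ht.1.le] using h8

end IsC0Semigroup

end

theorem mainTheorem9
    {H : Type*} [NormedAddCommGroup H] [InnerProductSpace ℂ H] [CompleteSpace H]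
    {U : Type*} [NormedAddCommGroup U] [InnerProductSpace ℂ U] [CompleteSpace U]
    (T₀ : ℝ) (hT₀ : 0 < T₀)
    -- the operator `A`, the semigroup `S t = e^{tA}` it generates, the control operator `B`
    (A : H →ₗ.[ℂ] H) (S : ℝ → H →L[ℂ] H) (hAS : Generates A S)
    (B : U →L[ℂ] H)
    -- the Hilbert spaces `U_T`, with their continuous dense injections into `L²(0,T; U)`
    (UT : ℝ → Type*) [∀ T, NormedAddCommGroup (UT T)] [∀ T, InnerProductSpace ℂ (UT T)]
    [∀ T, CompleteSpace (UT T)]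
    (ι : ∀ T : ℝ, UT T →L[ℂ] L2Control U T)
    (hι_inj : ∀ T : ℝ, 0 < T → Function.Injective (ι T))
    (hι_dense : ∀ T : ℝ, 0 < T → DenseRange (ι T))
    -- extension by zero
    (hext : ∀ T a b : ℝ, 0 < T → 0 < a → 0 < b → ∀ u : UT T, ∃ v : UT (T + a + b),
      (ι (T + a + b) v : ℝ → U) =ᵐ[volume.restrict (Ioo (0 : ℝ) (T + a + b))]
        (Ioo a (T + a)).indicator (fun t => (ι T u : ℝ → U) (t - a)))
    -- control up to finite dimension
    (F : Submodule ℂ H) (hF : FiniteDimensional ℂ F)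
    (hFS : ∀ t : ℝ, 0 ≤ t → ∀ x ∈ F, S t x ∈ F)
    (G : Submodule ℂ H) (hG_closed : IsClosed (G : Set H)) (hG : FiniteDimensional ℂ (H ⧸ G))
    (hcontrol : ∀ f₀ ∈ G, ∃ u : UT T₀, mildSolution S B f₀ (ι T₀ u) T₀ ∈ F)
    -- unique continuation
    (huc : ∀ ε : ℝ, 0 < ε → ∀ g₀ ∈ genEigenSpan A.adjoint,
      (∀ t ∈ Ioo (0 : ℝ) ε,
        ContinuousLinearMap.adjoint B (ContinuousLinearMap.adjoint (S t) g₀) = 0) → g₀ = 0) :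
    ∀ T : ℝ, T₀ < T → ∀ f₀ : H, ∃ u : UT T, mildSolution S B f₀ (ι T u) T = 0 := by
  intro T hT f
  have hS := hAS.isC0Semigroup
  let R : ℝ → Submodule ℂ H := fun t => hS.reach B (ι t)
  have hT0 : 0 < T := hT₀.trans hT
  have hR : ∀ t b t' : ℝ, 0 < t → 0 < b → t + b < t' → ∀ x ∈ R t, S b x ∈ R t' := by
    rintro t b t' ht hb htt x ⟨u, rfl⟩
    obtain ⟨a, rfl⟩ : ∃ a, t' = t + a + b := ⟨t' - t - b, by ring⟩
    have ha : 0 < a := by linarith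
    obtain ⟨v, hv⟩ := hext t a b ht ha hb u
    exact ⟨v, hS.inputMap_extend B ht.le ha.le hb.le _ _ hv⟩
  have hfin : FiniteDimensional ℂ (H ⧸ (R T₀).comap (S T₀ : H →ₗ[ℂ] H)) := by
    refine Submodule.finite_quotient_comap_of_map_le _ G F _ ?_
    rintro _ ⟨g, hg, rfl⟩
    obtain ⟨u, hu⟩ := hcontrol g hg
    rw [hS.mildSolution_eq B hT₀.le] at hu
    have h1 : hS.inputMap B T₀ (ι T₀ u) ∈ R T₀ := ⟨u, rfl⟩
    have h2 := Submodule.add_mem_sup hu (neg_mem h1)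
    rwa [add_neg_cancel_right] at h2
  obtain ⟨N, δ, hδ, hNcl, hNfin, hNS, hNR, hNT⟩ := hS.exists_stable_subspace R hR hT₀ hT hfin
    fun t => hS.isClosed_comap_reach B (ι t)
  rw [hS.mildSolution_eq_zero_iff B hT0.le]
  refine hNT ?_ f
  have : CompleteSpace N := hNcl.completeSpace_coe
  have : FiniteDimensional ℂ Nᗮ := LinearEquiv.finiteDimensional
    -- Closedness of `N` is essential: it makes `Nᗮ` a complement, so that `Nᗮ = 0` forces `N = ⊤`.
    (Submodule.quotientEquivOfIsCompl N Nᗮ N.isCompl_orthogonal)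
  have hW : ∀ t, 0 ≤ t → ∀ w ∈ Nᗮ, ContinuousLinearMap.adjoint (S t) w ∈ Nᗮ := fun t ht =>
    IsC0Semigroup.adjoint_invariant_orthogonal fun x hx =>
      hS.mem_of_forall_lt hδ (N := N) hNS ht hx
  rw [← Submodule.orthogonal_eq_bot_iff, Submodule.eq_bot_iff]
  intro w hw
  refine huc (δ / 2) (half_pos hδ) w (IsC0Semigroup.le_genEigenSpan_adjoint hAS hW hw) ?_
  refine hS.observation_eq_zero B hW hw (ι (δ / 2)) (hι_dense _ (half_pos hδ)) fun x hx => ?_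
  exact Submodule.inner_left_of_mem_orthogonal (hNR _ (half_pos hδ) (half_lt_self hδ) hx) hw
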